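/- Let $S=\{q_x,\rho_x\}_{x=1,2}$ be an ensemble of two qubit states $\rho_x=\frac12(\mathbb I+\vec v_x\cdot\vec\sigma)$ with a priori probabilities $q_1>q_2\ge 0$, $q_1+q_2=1$, where $\vec\sigma$ is the vector of Pauli matrices. A measurement (POVM) $M=\{M_1,M_2\}$, $M_x\ge 0$, $M_1+M_2=\mathbb I$, is optimal for $S$ if it maximizes $\sum_x q_x\,\mathrm{tr}[M_x\rho_x]$, and $P_{\mathrm g}$ denotes the maximum. Assume that the discrimination problem is non-trivial, that is, $P_{\mathrm g}>q_1$ (always guessing the more probable state without measuring is not optimal). Let $\mathcal N$ be a completely positive trace preserving (CPTP) map on qubit operators, written as $\mathcal N\big(\frac12(\mathbb I+\vec v\cdot\vec\sigma)\big)=\frac12\big(\mathbb I+(D\vec v+\vec t\,)\cdot\vec\sigma\big)$ with a real $3\times3$ matrix $D$ and $\vec t\in\mathbb R^3$. The map $\mathcal N$ is called optimal measurement preserving (OMP) for $S$ if an optimal measurement for $S$ is also optimal for $\{q_x,\mathcal N(\rho_x)\}_{x=1,2}$; it makes no difference here whether this is required of some optimal measurement or of all of them. Put $$\vec h=\frac{q_1\vec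 v_1-q_2\vec v_2}{q_1-q_2},\qquad h_{12}=q_1\rho_1-q_2\rho_2 .$$ Then $\mathcal N$ is OMP for $S$ if and only if there exist real numbers $\lambda,\mu$ with $$1\ \ge\ \lambda\ \ge\ \frac{2q_1-1}{2P_{\mathrm g}-1},\qquad 0\ \le\ \mu\ \le\ \frac{q_1-q_2}{2}\cdot\frac{P_{\mathrm g}-q_1}{P_{\mathrm g}-\frac12}$$ such that $$\vec t=-(D-\lambda\mathbb I)\vec h\qquad\text{and}\qquad \mu=(1-\lambda)\,\frac{q_1-q_2}{2}.$$ For any real $\lambda,\mu$ these two equations hold if and only if $\mathcal N(h_{12})=\lambda h_{12}+\mu\mathbb I$. Moreover, if $\mathcal N$ is unital, $\mathcal N(\mathbb I)=\mathbb I$, then $\vec t=0$, and $\mathcal N$ is OMP for $S$ if and only if there is a $\lambda$ with $1\ge\lambda\ge\frac{2q_1-1}{2P_{\mathrm g}-1}$ and $\vec h\in\ker(D-\lambda\mathbb I)$. -/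

import Mathlib

open scoped ComplexOrder

/-- Operators on a single qubit. -/
abbrev QubitOp : Type := Matrix (Fin 2) (Fin 2) ℂ

/-- A qubit state: a density matrix. -/
def IsQubitState (ρ : QubitOp) : Prop :=
  ρ.PosSemidef ∧ ρ.trace = 1

/-- The Pauli matrices `σ_1, σ_2, σ_3`. -/
noncomputable def pauli : Fin 3 → QubitOp :=
  ![!![0, 1; 1, 0], !![0, -Complex.I; Complex.I, 0], !![1, 0; 0, -1]]

/-- The operator `(I + v · σ) / 2` with Bloch vector `v`. -/
noncomputable def blochOp (v : Fin 3 → ℝ) : QubitOp :=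
  (1 / 2 : ℂ) • (1 + ∑ i, (v i : ℂ) • pauli i)

/-- The map `N ⊗ id_k` on operators of a qubit and a `k`-dimensional ancilla. -/
def ampliation (N : QubitOp →ₗ[ℂ] QubitOp) (k : ℕ)
    (X : Matrix (Fin 2 × Fin k) (Fin 2 × Fin k) ℂ) :
    Matrix (Fin 2 × Fin k) (Fin 2 × Fin k) ℂ :=
  Matrix.of fun a b => N (Matrix.of fun i j => X (i, a.2) (j, b.2)) a.1 b.1

/-- Completely positive, trace preserving maps on qubit operators. -/
def IsCPTP (N : QubitOp →ₗ[ℂ] QubitOp) : Prop :=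
  (∀ (k : ℕ) (X : Matrix (Fin 2 × Fin k) (Fin 2 × Fin k) ℂ),
      X.PosSemidef → (ampliation N k X).PosSemidef) ∧
    ∀ X : QubitOp, (N X).trace = X.trace

/-- `N` is the map `(D, t)`: it sends `(I + v · σ) / 2` to `(I + (D v + t) · σ) / 2`. -/
def IsBlochForm (N : QubitOp →ₗ[ℂ] QubitOp)
    (D : Matrix (Fin 3) (Fin 3) ℝ) (t : Fin 3 → ℝ) : Prop :=
  ∀ v : Fin 3 → ℝ, N (blochOp v) = blochOp (D.mulVec v + t)

/-- A positive operator-valued measure with `n` outcomes. -/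
def IsPOVM {n : ℕ} (M : Fin n → QubitOp) : Prop :=
  (∀ x, (M x).PosSemidef) ∧ ∑ x, M x = 1

/-- The probability `∑ q_x tr[M_x ρ_x]` of guessing correctly with the measurement `M`. -/
noncomputable def successProb {n : ℕ} (q : Fin n → ℝ) (ρ : Fin n → QubitOp)
    (M : Fin n → QubitOp) : ℝ :=
  ∑ x, q x * (M x * ρ x).trace.re

/-- The guessing probability of an ensemble: the optimum of the success probability. -/
noncomputable def guessProb {n : ℕ} (q : Fin n → ℝ) (ρ : Fin n → QubitOp) : ℝ :=
  sSup {p | ∃ M : Fin n → QubitOp, IsPOVM M ∧ p = successProb q ρ M}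

/-- `M` is an optimal measurement for the ensemble `{q_x, ρ_x}`. -/
def IsOptimalMeasurement {n : ℕ} (q : Fin n → ℝ) (ρ : Fin n → QubitOp)
    (M : Fin n → QubitOp) : Prop :=
  IsPOVM M ∧ ∀ M' : Fin n → QubitOp, IsPOVM M' → successProb q ρ M' ≤ successProb q ρ M

/-- `N` preserves the optimal measurement `M` of the ensemble `{q_x, ρ_x}`: the POVM `M` is
optimal both for that ensemble and for `{q_x, N[ρ_x]}`. -/
def PreservesOptimal {n : ℕ} (N : QubitOp →ₗ[ℂ] QubitOp) (q : Fin n → ℝ)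
    (ρ : Fin n → QubitOp) (M : Fin n → QubitOp) : Prop :=
  IsOptimalMeasurement q ρ M ∧ IsOptimalMeasurement q (fun x => N (ρ x)) M

/-- `N` preserves at least one optimal measurement of the ensemble. -/
def IsWeakOMP {n : ℕ} (N : QubitOp →ₗ[ℂ] QubitOp) (q : Fin n → ℝ)
    (ρ : Fin n → QubitOp) : Prop :=
  ∃ M, PreservesOptimal N q ρ M

/-- `N` preserves every optimal measurement of the ensemble. -/
def IsStrongOMP {n : ℕ} (N : QubitOp →ₗ[ℂ] QubitOp) (q : Fin n → ℝ)
    (ρ : Fin n → QubitOp) : Prop :=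
  ∀ M, IsOptimalMeasurement q ρ M → PreservesOptimal N q ρ M

/-- The Helstrom operator `q_1 ρ_1 - q_2 ρ_2` of a pair (the indices are `0` and `1`). -/
noncomputable def helstromOp (q : Fin 2 → ℝ) (ρ : Fin 2 → QubitOp) : QubitOp :=
  (q 0 : ℂ) • ρ 0 - (q 1 : ℂ) • ρ 1

/-- The vector `h = (q_1 v_1 - q_2 v_2) / (q_1 - q_2)`. -/
noncomputable def helstromVec (q : Fin 2 → ℝ) (v : Fin 2 → Fin 3 → ℝ) : Fin 3 → ℝ :=
  (q 0 - q 1)⁻¹ • (q 0 • v 0 - q 1 • v 1)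

/-- The permissible values of `λ`, where `P` is the guessing probability. -/
def LambdaRange (q : Fin 2 → ℝ) (P : ℝ) : Set ℝ :=
  Set.Icc ((2 * q 0 - 1) / (2 * P - 1)) 1

/-- The permissible values of `μ`, where `P` is the guessing probability. -/
def MuRange (q : Fin 2 → ℝ) (P : ℝ) : Set ℝ :=
  Set.Icc 0 ((q 0 - q 1) / 2 * ((P - q 0) / (P - 1 / 2)))

/-! Write `d = q 0 - q 1`, `w = q 0 • v 0 - q 1 • v 1` and `n = |w|`. A binary POVM has first
element `(s I + a · σ) / 2` with `|a| ≤ min s (2 - s)`, and its success probability is `q 1 + (s d +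
a · w) / 2`. Non-triviality amounts to `d < n`; then the unique maximizer is `s = 1`, `a = u = w /
n` with value `(1 + n) / 2`, so the weak and strong notions agree. The channel replaces `w` by `D w
+ d t` and keeps `d`. By `isOptimalMeasurement_blochMeasurement_iff` the measurement along `u` stays
optimal iff `D w + d t = c u` with `d ≤ c`, and positivity of the channel forces `c ≤ n`
(`IsCPTP.dotProduct_le`). So `λ = c / n` ranges over `[d / n, 1]`, where `d / n = (2 q 0 - 1) / (2 P
- 1)`; trace preservation then fixes `μ`. -/

section Auxiliary

open Matrix

/-! ### Pauli coordinates of Hermitian qubit operators -/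

/-- The qubit operator `(s I + a · σ) / 2`. -/
noncomputable def pauliComb (s : ℝ) (a : Fin 3 → ℝ) : QubitOp :=
  (1 / 2 : ℂ) • ((s : ℂ) • (1 : QubitOp) + ∑ i, (a i : ℂ) • pauli i)

theorem pauliComb_eq (s : ℝ) (a : Fin 3 → ℝ) :
    pauliComb s a =
      !![((s : ℂ) + a 2) / 2, ((a 0 : ℂ) - a 1 * Complex.I) / 2;
        ((a 0 : ℂ) + a 1 * Complex.I) / 2, ((s : ℂ) - a 2) / 2] := by
  ext i j
  fin_cases i <;> fin_cases j <;>
    simp [pauliComb, pauli, Fin.sum_univ_three] <;> ring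

theorem blochOp_eq_pauliComb (a : Fin 3 → ℝ) : blochOp a = pauliComb 1 a := by
  simp [blochOp, pauliComb]

theorem pauliComb_injective {s r : ℝ} {a b : Fin 3 → ℝ} (h : pauliComb s a = pauliComb r b) :
    s = r ∧ a = b := by
  rw [pauliComb_eq, pauliComb_eq] at h
  have h00 := congrFun (congrFun h 0) 0
  have h10 := congrFun (congrFun h 1) 0
  have h11 := congrFun (congrFun h 1) 1
  simp only [Fin.isValue, of_apply, cons_val', cons_val_zero, cons_val_one, cons_val_fin_one]
    at h00 h10 h11
  have e0 := congrArg Complex.re h00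
  have e1 := congrArg Complex.re h11
  have e2 := congrArg Complex.re h10
  have e3 := congrArg Complex.im h10
  simp at e0 e1 e2 e3
  refine ⟨by linarith, ?_⟩
  ext i
  fin_cases i
  · simpa using e2
  · simpa using e3
  · simp only [Fin.reduceFinMk]
    linarith

theorem smul_pauliComb (c s : ℝ) (a : Fin 3 → ℝ) :
    (c : ℂ) • pauliComb s a = pauliComb (c * s) (c • a) := by
  rw [pauliComb_eq, pauliComb_eq]
  ext i j
  fin_cases i <;> fin_cases j <;> simp <;> ring

theorem pauliComb_add (s r : ℝ) (a b : Fin 3 → ℝ) :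
    pauliComb s a + pauliComb r b = pauliComb (s + r) (a + b) := by
  rw [pauliComb_eq, pauliComb_eq, pauliComb_eq]
  ext i j
  fin_cases i <;> fin_cases j <;> simp <;> ring

theorem pauliComb_sub (s r : ℝ) (a b : Fin 3 → ℝ) :
    pauliComb s a - pauliComb r b = pauliComb (s - r) (a - b) := by
  rw [pauliComb_eq, pauliComb_eq, pauliComb_eq]
  ext i j
  fin_cases i <;> fin_cases j <;> simp <;> ring

theorem pauliComb_two_zero : pauliComb 2 0 = 1 := by
  simp [pauliComb, smul_smul]

theorem pauliComb_zero_zero : pauliComb 0 0 = 0 := by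
  simp [pauliComb]

theorem trace_pauliComb (s : ℝ) (a : Fin 3 → ℝ) : (pauliComb s a).trace = s := by
  rw [pauliComb_eq, trace_fin_two_of]
  ring

theorem det_pauliComb (s : ℝ) (a : Fin 3 → ℝ) :
    (pauliComb s a).det = ((s ^ 2 - a ⬝ᵥ a) / 4 : ℝ) := by
  rw [pauliComb_eq, det_fin_two_of]
  simp only [dotProduct, Fin.sum_univ_three]
  push_cast
  linear_combination (-(a 1 : ℂ) ^ 2 / 4) * (-1 : ℂ) * Complex.I_sq

theorem re_trace_pauliComb_mul (s r : ℝ) (a b : Fin 3 → ℝ) :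
    (pauliComb s a * pauliComb r b).trace.re = (s * r + a ⬝ᵥ b) / 2 := by
  rw [pauliComb_eq, pauliComb_eq, trace_fin_two]
  simp [mul_apply, Fin.sum_univ_two, dotProduct, Fin.sum_univ_three]
  ring

theorem isHermitian_pauliComb (s : ℝ) (a : Fin 3 → ℝ) : (pauliComb s a).IsHermitian := by
  rw [pauliComb_eq]
  ext i j
  fin_cases i <;> fin_cases j <;> simp [Complex.ext_iff]

theorem exists_eq_pauliComb {A : QubitOp} (hA : A.IsHermitian) : ∃ s a, A = pauliComb s a := by
  refine ⟨(A 0 0).re + (A 1 1).re,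
    ![2 * (A 1 0).re, 2 * (A 1 0).im, (A 0 0).re - (A 1 1).re], ?_⟩
  have h0 := hA.apply 0 0
  have h1 := hA.apply 1 1
  have h2 := hA.apply 0 1
  have e0 := congrArg Complex.im h0
  have e1 := congrArg Complex.im h1
  have e2 := congrArg Complex.re h2
  have e3 := congrArg Complex.im h2
  simp at e0 e1 e2 e3
  rw [pauliComb_eq]
  ext i j
  fin_cases i <;> fin_cases j <;> simp [Complex.ext_iff] <;> try constructor
  all_goals linarith

theorem bounds_of_posSemidef_pauliComb {s : ℝ} {a : Fin 3 → ℝ} (h : (pauliComb s a).PosSemidef) :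
    0 ≤ s ∧ a ⬝ᵥ a ≤ s ^ 2 := by
  have h1 := h.trace_nonneg
  have h2 := h.det_nonneg
  rw [trace_pauliComb] at h1
  rw [det_pauliComb] at h2
  have h1' : 0 ≤ s := by exact_mod_cast h1
  have h2' : 0 ≤ (s ^ 2 - a ⬝ᵥ a) / 4 := by exact_mod_cast h2
  exact ⟨h1', by linarith⟩

/-- For a unit vector the operator is a projection, hence of the form `Aᴴ * A`. -/
theorem posSemidef_blochOp {a : Fin 3 → ℝ} (ha : a ⬝ᵥ a = 1) : (blochOp a).PosSemidef := by
  rw [blochOp_eq_pauliComb]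
  have h : (pauliComb 1 a)ᴴ * pauliComb 1 a = pauliComb 1 a := by
    rw [isHermitian_pauliComb 1 a, pauliComb_eq]
    simp only [dotProduct, Fin.sum_univ_three] at ha
    have hc : (a 0 : ℂ) * a 0 + a 1 * a 1 + a 2 * a 2 = 1 := by exact_mod_cast ha
    ext i j
    fin_cases i <;> fin_cases j <;> simp [mul_apply, Fin.sum_univ_two]
    · linear_combination hc / 4 - (a 1 : ℂ) ^ 2 / 4 * Complex.I_sq
    · ring
    · ring
    · linear_combination hc / 4 - (a 1 : ℂ) ^ 2 / 4 * Complex.I_sq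
  rw [← h]
  exact posSemidef_conjTranspose_mul_self _

/-! ### Binary measurements in Bloch coordinates -/

/-- The projective measurement along the Bloch direction `u`. -/
noncomputable def blochMeasurement (u : Fin 3 → ℝ) : Fin 2 → QubitOp :=
  ![blochOp u, blochOp (-u)]

theorem isPOVM_blochMeasurement {u : Fin 3 → ℝ} (hu : u ⬝ᵥ u = 1) :
    IsPOVM (blochMeasurement u) := by
  refine ⟨fun x => ?_, ?_⟩
  · fin_cases x
    · exact posSemidef_blochOp hu
    · exact posSemidef_blochOp (by simpa using hu)
  · simp only [Fin.sum_univ_two, blochMeasurement, cons_val_zero, cons_val_one,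
      blochOp_eq_pauliComb, pauliComb_add]
    norm_num [pauliComb_two_zero]

theorem IsPOVM.exists_pauliComb {M : Fin 2 → QubitOp} (hM : IsPOVM M) :
    ∃ s a, M 0 = pauliComb s a ∧ M 1 = pauliComb (2 - s) (-a) ∧
      0 ≤ s ∧ s ≤ 2 ∧ a ⬝ᵥ a ≤ s ^ 2 ∧ a ⬝ᵥ a ≤ (2 - s) ^ 2 := by
  obtain ⟨s, a, hs⟩ := exists_eq_pauliComb (hM.1 0).isHermitian
  have h1 : M 1 = pauliComb (2 - s) (-a) := by
    have := hM.2
    rw [Fin.sum_univ_two, hs, ← pauliComb_two_zero] at this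
    rw [eq_sub_of_add_eq' this, pauliComb_sub, zero_sub]
  have b0 := bounds_of_posSemidef_pauliComb (hs ▸ hM.1 0)
  have b1 := bounds_of_posSemidef_pauliComb (h1 ▸ hM.1 1)
  simp only [neg_dotProduct_neg] at b1
  exact ⟨s, a, hs, h1, b0.1, by linarith [b1.1], b0.2, b1.2⟩

theorem successProb_pauliComb (q : Fin 2 → ℝ) (v : Fin 2 → Fin 3 → ℝ)
    {M : Fin 2 → QubitOp} {s : ℝ} {a : Fin 3 → ℝ} (h0 : M 0 = pauliComb s a)
    (h1 : M 1 = pauliComb (2 - s) (-a)) :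
    successProb q (fun x => blochOp (v x)) M =
      q 1 + (s * (q 0 - q 1) + a ⬝ᵥ (q 0 • v 0 - q 1 • v 1)) / 2 := by
  simp only [successProb, Fin.sum_univ_two, h0, h1, blochOp_eq_pauliComb, re_trace_pauliComb_mul,
    dotProduct_sub, dotProduct_smul, neg_dotProduct, smul_eq_mul]
  ring

theorem successProb_blochMeasurement (q : Fin 2 → ℝ) (v : Fin 2 → Fin 3 → ℝ)
    (u : Fin 3 → ℝ) :
    successProb q (fun x => blochOp (v x)) (blochMeasurement u) =
      q 1 + ((q 0 - q 1) + u ⬝ᵥ (q 0 • v 0 - q 1 • v 1)) / 2 := by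
  rw [successProb_pauliComb q v (s := 1) (a := u), one_mul]
  · simp [blochMeasurement, blochOp_eq_pauliComb]
  · norm_num [blochMeasurement, blochOp_eq_pauliComb]

theorem dotProduct_self_real_nonneg (w : Fin 3 → ℝ) : 0 ≤ w ⬝ᵥ w :=
  Finset.sum_nonneg fun i _ => mul_self_nonneg (w i)

theorem dotProduct_le_mul_of_sq_le {a w : Fin 3 → ℝ} {r n : ℝ} (hr : 0 ≤ r) (hn : 0 ≤ n)
    (ha : a ⬝ᵥ a ≤ r ^ 2) (hw : w ⬝ᵥ w ≤ n ^ 2) : a ⬝ᵥ w ≤ r * n := by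
  refine abs_le_of_sq_le_sq' ?_ (mul_nonneg hr hn) |>.2
  have h := Finset.sum_mul_sq_le_sq_mul_sq Finset.univ a w
  have h0 : 0 ≤ w ⬝ᵥ w := dotProduct_self_real_nonneg w
  calc (a ⬝ᵥ w) ^ 2 ≤ (a ⬝ᵥ a) * (w ⬝ᵥ w) := by
        simpa only [dotProduct, ← sq] using h
    _ ≤ r ^ 2 * n ^ 2 := mul_le_mul ha hw h0 (sq_nonneg r)
    _ = (r * n) ^ 2 := by ring

/-- Equality case of Cauchy–Schwarz: the hypotheses force `|w - c u|² ≤ 0`. -/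
theorem eq_smul_of_dotProduct {u w : Fin 3 → ℝ} {c : ℝ} (hu : u ⬝ᵥ u ≤ 1)
    (hw : w ⬝ᵥ w ≤ c ^ 2) (huw : u ⬝ᵥ w = c) : w = c • u := by
  have h : (w - c • u) ⬝ᵥ (w - c • u) = w ⬝ᵥ w - 2 * c * (u ⬝ᵥ w) + c ^ 2 * (u ⬝ᵥ u) := by
    simp only [dotProduct, Fin.sum_univ_three, Pi.sub_apply, Pi.smul_apply, smul_eq_mul]
    ring
  have h0 : (w - c • u) ⬝ᵥ (w - c • u) = 0 := by
    refine le_antisymm ?_ (dotProduct_self_real_nonneg _)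
    rw [h, huw]
    nlinarith [sq_nonneg c]
  exact sub_eq_zero.mp (dotProduct_self_eq_zero.mp h0)

/-! ### Optimality and uniqueness -/

/-- A projective measurement along a unit vector `u` is optimal precisely if the Helstrom
vector is a multiple of `u` that is long enough. -/
theorem isOptimalMeasurement_blochMeasurement_iff {q : Fin 2 → ℝ}
    (hlt : q 1 < q 0) (v : Fin 2 → Fin 3 → ℝ) {u : Fin 3 → ℝ} (hu : u ⬝ᵥ u = 1) :
    IsOptimalMeasurement q (fun x => blochOp (v x)) (blochMeasurement u) ↔
      ∃ c, q 0 - q 1 ≤ c ∧ q 0 • v 0 - q 1 • v 1 = c • u := by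
  set w := q 0 • v 0 - q 1 • v 1 with hw
  constructor
  · rintro ⟨-, hopt⟩
    -- Comparison with always guessing the first state gives `d ≤ u · w`.
    have htriv : IsPOVM ![(1 : QubitOp), 0] := by
      refine ⟨fun x => ?_, by simp⟩
      fin_cases x
      · exact PosSemidef.one
      · exact PosSemidef.zero
    have h1 := hopt _ htriv
    rw [successProb_blochMeasurement q, successProb_pauliComb q v (s := 2) (a := 0)
      (by simp [pauliComb_two_zero]) (by simp [pauliComb_zero_zero]), ← hw, zero_dotProduct] at h1
    have hc : q 0 - q 1 ≤ u ⬝ᵥ w := by linarith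
    have hw0 : 0 < w ⬝ᵥ w := by
      refine lt_of_le_of_ne (dotProduct_self_real_nonneg w) fun h => ?_
      rw [dotProduct_self_eq_zero.mp h.symm, dotProduct_zero] at hc
      linarith
    set n := √(w ⬝ᵥ w) with hn
    have hn0 : 0 < n := Real.sqrt_pos.mpr hw0
    have hnsq : n ^ 2 = w ⬝ᵥ w := Real.sq_sqrt hw0.le
    -- Comparison with the direction of `w` itself gives `|w| ≤ u · w`, so `w` is parallel to `u`.
    have h2 := hopt (blochMeasurement (n⁻¹ • w)) (isPOVM_blochMeasurement (by
      rw [smul_dotProduct, dotProduct_smul, ← hnsq, smul_eq_mul, smul_eq_mul]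
      field_simp))
    rw [successProb_blochMeasurement q, successProb_blochMeasurement q, ← hw, smul_dotProduct,
      ← hnsq, smul_eq_mul, show n⁻¹ * n ^ 2 = n by field_simp] at h2
    refine ⟨u ⬝ᵥ w, hc, eq_smul_of_dotProduct hu.le ?_ rfl⟩
    rw [← hnsq]
    exact pow_le_pow_left₀ hn0.le (by linarith) 2
  · rintro ⟨c, hc, hcw⟩
    refine ⟨isPOVM_blochMeasurement hu, fun M hM => ?_⟩
    obtain ⟨s, a, h0, h1, hs0, hs2, ha1, ha2⟩ := hM.exists_pauliComb
    rw [successProb_blochMeasurement q, successProb_pauliComb q v h0 h1, ← hw, hcw,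
      dotProduct_smul, dotProduct_smul, hu, smul_eq_mul, smul_eq_mul]
    have b1 := dotProduct_le_mul_of_sq_le hs0 zero_le_one ha1 (by rw [hu]; norm_num)
    have b2 := dotProduct_le_mul_of_sq_le (sub_nonneg.mpr hs2) zero_le_one ha2
      (by rw [hu]; norm_num)
    -- For `s ≤ 1` use `s d + a · w ≤ s (d + c)`; for `s ≥ 1` use `s d + (2 - s) c`, which is at
    -- most `d + c` because `d ≤ c`.
    rcases le_total s 1 with h | h <;> nlinarith

/-- With `d < c` strict, any `s ≠ 1` loses; at `s = 1` optimality forces `a · u = 1` with `|a| ≤ 1`.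
-/
theorem eq_blochMeasurement_of_isOptimalMeasurement {q : Fin 2 → ℝ}
    (hlt : q 1 < q 0) (v : Fin 2 → Fin 3 → ℝ) {u : Fin 3 → ℝ} (hu : u ⬝ᵥ u = 1) {c : ℝ}
    (hc : q 0 - q 1 < c) (hcw : q 0 • v 0 - q 1 • v 1 = c • u) {M : Fin 2 → QubitOp}
    (hM : IsOptimalMeasurement q (fun x => blochOp (v x)) M) : M = blochMeasurement u := by
  obtain ⟨s, a, h0, h1, hs0, hs2, ha1, ha2⟩ := hM.1.exists_pauliComb
  have hopt := hM.2 _ (isPOVM_blochMeasurement hu)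
  rw [successProb_blochMeasurement q, successProb_pauliComb q v h0 h1, hcw,
    dotProduct_smul, dotProduct_smul, hu, smul_eq_mul, smul_eq_mul] at hopt
  have b1 := dotProduct_le_mul_of_sq_le hs0 zero_le_one ha1 (by rw [hu]; norm_num)
  have b2 := dotProduct_le_mul_of_sq_le (sub_nonneg.mpr hs2) zero_le_one ha2
    (by rw [hu]; norm_num)
  have hs : s = 1 := by
    apply le_antisymm
    · by_contra! h
      nlinarith
    · by_contra! h
      nlinarith
  subst hs
  have hau : a = u := by
    rw [eq_smul_of_dotProduct (u := u) (w := a) (c := 1) hu.le ha1, one_smul]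
    rw [dotProduct_comm]
    refine le_antisymm (by linarith) ?_
    by_contra! h
    nlinarith
  subst hau
  ext x : 1
  fin_cases x
  · simpa [blochMeasurement, blochOp_eq_pauliComb] using h0
  · simp only [blochMeasurement, blochOp_eq_pauliComb]
    norm_num at h1
    exact h1

theorem guessProb_eq_of_isOptimalMeasurement {n : ℕ} {q : Fin n → ℝ} {ρ M : Fin n → QubitOp}
    (hM : IsOptimalMeasurement q ρ M) : guessProb q ρ = successProb q ρ M :=
  IsGreatest.csSup_eq ⟨⟨M, hM.1, rfl⟩, by rintro _ ⟨M', hM', rfl⟩; exact hM.2 M' hM'⟩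

/-- If guessing without a measurement is not optimal, the Helstrom vector is longer than the
difference of the prior probabilities. -/
theorem sq_lt_dotProduct_of_lt_guessProb {q : Fin 2 → ℝ}
    (hlt : q 1 < q 0) (v : Fin 2 → Fin 3 → ℝ)
    (h : q 0 < guessProb q (fun x => blochOp (v x))) :
    (q 0 - q 1) ^ 2 < (q 0 • v 0 - q 1 • v 1) ⬝ᵥ (q 0 • v 0 - q 1 • v 1) := by
  by_contra! hle
  refine h.not_ge (csSup_le
    ⟨_, blochMeasurement ![1, 0, 0], isPOVM_blochMeasurement (by simp), rfl⟩ ?_)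
  rintro _ ⟨M, hM, rfl⟩
  obtain ⟨s, a, h0, h1, hs0, hs2, ha1, ha2⟩ := hM.exists_pauliComb
  rw [successProb_pauliComb q v h0 h1]
  -- If `|w| ≤ d`, then `a · w ≤ (2 - s) d`, which caps the success probability at `q 1 + d = q 0`.
  have b2 := dotProduct_le_mul_of_sq_le (sub_nonneg.mpr hs2) (sub_nonneg.mpr hlt.le) ha2 hle
  linarith

/-! ### Action of the channel on Helstrom data -/

theorem IsCPTP.posSemidef_map {N : QubitOp →ₗ[ℂ] QubitOp} (hN : IsCPTP N) {A : QubitOp}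
    (hA : A.PosSemidef) : (N A).PosSemidef := by
  -- Positivity is the case of a one-dimensional ancilla.
  have h := hN.1 1 (A.submatrix Prod.fst Prod.fst) (hA.submatrix _)
  exact h.submatrix (fun i => (i, 0))

/-- Contractivity of the Bloch form of a positive map on Helstrom vectors. -/
theorem IsCPTP.dotProduct_le {N : QubitOp →ₗ[ℂ] QubitOp} (hN : IsCPTP N)
    {D : Matrix (Fin 3) (Fin 3) ℝ} {t : Fin 3 → ℝ} (hDt : IsBlochForm N D t)
    {u : Fin 3 → ℝ} (hu : u ⬝ᵥ u = 1) {d n : ℝ} (hd : -n ≤ d) (hdn : d ≤ n) :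
    u ⬝ᵥ (n • D.mulVec u + d • t) ≤ n := by
  have key : ∀ a : Fin 3 → ℝ, a ⬝ᵥ a = 1 → (D.mulVec a + t) ⬝ᵥ (D.mulVec a + t) ≤ 1 ^ 2 := by
    intro a ha
    have h := hN.posSemidef_map (posSemidef_blochOp ha)
    rw [hDt, blochOp_eq_pauliComb] at h
    exact (bounds_of_posSemidef_pauliComb h).2
  have h1 := dotProduct_le_mul_of_sq_le zero_le_one zero_le_one (hu.le.trans (by norm_num))
    (key u hu)
  have hu' : (-u) ⬝ᵥ (-u) = 1 := by rwa [neg_dotProduct_neg]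
  have h2 := dotProduct_le_mul_of_sq_le zero_le_one zero_le_one (hu'.le.trans (by norm_num))
    (key (-u) hu')
  simp only [dotProduct_add, neg_dotProduct, dotProduct_smul, mulVec_neg, dotProduct_neg,
    smul_eq_mul, neg_neg] at h1 h2 ⊢
  -- Combine the bounds at `u` and `-u` with the nonnegative weights `(n + d) / 2` and `(n - d) /
  -- 2`, whose sum is `n`.
  nlinarith

theorem eq_neg_sub_smul_mulVec_iff {D : Matrix (Fin 3) (Fin 3) ℝ} {t w : Fin 3 → ℝ} {d : ℝ}
    (hd : d ≠ 0) (lam : ℝ) :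
    t = -((D - lam • (1 : Matrix (Fin 3) (Fin 3) ℝ)).mulVec (d⁻¹ • w)) ↔
      D.mulVec w + d • t = lam • w := by
  rw [sub_mulVec, smul_mulVec, one_mulVec, mulVec_smul]
  constructor
  · intro h
    rw [h, smul_neg, smul_sub, smul_inv_smul₀ hd, smul_comm lam, smul_inv_smul₀ hd]
    abel
  · intro h
    rw [smul_comm lam, ← h, smul_add, inv_smul_smul₀ hd]
    abel

/-- A map in Bloch form keeps the projective measurement along the Helstrom vector optimal
precisely if it scales the Helstrom vector by a permissible factor. -/
theorem isOptimalMeasurement_map_iff {q : Fin 2 → ℝ} {v : Fin 2 → Fin 3 → ℝ}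
    {N : QubitOp →ₗ[ℂ] QubitOp} {D : Matrix (Fin 3) (Fin 3) ℝ} {t : Fin 3 → ℝ}
    (hlt : q 1 < q 0) (hN : IsCPTP N) (hDt : IsBlochForm N D t)
    {u : Fin 3 → ℝ} (hu : u ⬝ᵥ u = 1) {n : ℝ} (hn : q 0 - q 1 < n)
    (hw : q 0 • v 0 - q 1 • v 1 = n • u) :
    IsOptimalMeasurement q (fun x => N (blochOp (v x))) (blochMeasurement u) ↔
      ∃ lam ∈ Set.Icc ((q 0 - q 1) / n) 1,
        D.mulVec (q 0 • v 0 - q 1 • v 1) + (q 0 - q 1) • t =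
          lam • (q 0 • v 0 - q 1 • v 1) := by
  have hn0 : 0 < n := by linarith
  have hmap : (fun x => N (blochOp (v x))) = fun x => blochOp (D.mulVec (v x) + t) :=
    funext fun x => hDt (v x)
  have hvec : q 0 • (D.mulVec (v 0) + t) - q 1 • (D.mulVec (v 1) + t) =
      D.mulVec (q 0 • v 0 - q 1 • v 1) + (q 0 - q 1) • t := by
    rw [mulVec_sub, mulVec_smul, mulVec_smul, sub_smul, smul_add, smul_add]
    abel
  rw [hmap, isOptimalMeasurement_blochMeasurement_iff hlt (fun x => D.mulVec (v x) + t) hu,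
    hvec, hw]
  constructor
  · rintro ⟨c, hc, hcu⟩
    have hcn : c ≤ n := by
      have h := hN.dotProduct_le hDt hu (d := q 0 - q 1) (n := n) (by linarith) hn.le
      rwa [← mulVec_smul, hcu, dotProduct_smul, hu, smul_eq_mul, mul_one] at h
    refine ⟨c / n, ⟨by gcongr, (div_le_one hn0).mpr hcn⟩, ?_⟩
    rw [hcu, smul_smul, div_mul_cancel₀ _ hn0.ne']
  · rintro ⟨lam, hlam, h⟩
    exact ⟨lam * n, (div_le_iff₀ hn0).mp hlam.1, by rw [h, smul_smul]⟩

theorem map_helstromOp_eq_iff {q : Fin 2 → ℝ} {v : Fin 2 → Fin 3 → ℝ}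
    {N : QubitOp →ₗ[ℂ] QubitOp} {D : Matrix (Fin 3) (Fin 3) ℝ} {t : Fin 3 → ℝ}
    (hDt : IsBlochForm N D t) (lam mu : ℝ) :
    N (helstromOp q fun x => blochOp (v x)) =
        (lam : ℂ) • helstromOp q (fun x => blochOp (v x)) + (mu : ℂ) • (1 : QubitOp) ↔
      D.mulVec (q 0 • v 0 - q 1 • v 1) + (q 0 - q 1) • t = lam • (q 0 • v 0 - q 1 • v 1) ∧
        mu = (1 - lam) * ((q 0 - q 1) / 2) := by
  have hK : ∀ v : Fin 2 → Fin 3 → ℝ, helstromOp q (fun x => blochOp (v x)) =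
      pauliComb (q 0 - q 1) (q 0 • v 0 - q 1 • v 1) := by
    intro v
    simp only [helstromOp, blochOp_eq_pauliComb, smul_pauliComb, pauliComb_sub, mul_one]
  have hNK : N (helstromOp q fun x => blochOp (v x)) =
      pauliComb (q 0 - q 1) (D.mulVec (q 0 • v 0 - q 1 • v 1) + (q 0 - q 1) • t) := by
    have hvec : D.mulVec (q 0 • v 0 - q 1 • v 1) + (q 0 - q 1) • t =
        q 0 • (D.mulVec (v 0) + t) - q 1 • (D.mulVec (v 1) + t) := by
      rw [mulVec_sub, mulVec_smul, mulVec_smul, sub_smul, smul_add, smul_add]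
      abel
    rw [hvec, ← hK fun x => D.mulVec (v x) + t]
    simp only [helstromOp, map_sub, map_smul, hDt _]
  rw [hNK, hK, ← pauliComb_two_zero, smul_pauliComb, smul_pauliComb, pauliComb_add, smul_zero,
    add_zero]
  constructor
  · intro h
    obtain ⟨h1, h2⟩ := pauliComb_injective h
    exact ⟨h2, by linarith⟩
  · rintro ⟨h1, h2⟩
    rw [h1, h2]
    congr 1
    ring

/-- The image of `I / 2`, the operator with zero Bloch vector, has Bloch vector `t`. -/
theorem IsBlochForm.eq_zero_of_unital {N : QubitOp →ₗ[ℂ] QubitOp}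
    {D : Matrix (Fin 3) (Fin 3) ℝ} {t : Fin 3 → ℝ} (hDt : IsBlochForm N D t) (h1 : N 1 = 1) :
    t = 0 := by
  have h0 := hDt 0
  rw [mulVec_zero, zero_add, blochOp_eq_pauliComb, blochOp_eq_pauliComb] at h0
  have h2 : ((2 : ℝ) : ℂ) • pauliComb 1 0 = 1 := by
    rw [smul_pauliComb, mul_one, smul_zero, pauliComb_two_zero]
  have h3 := congrArg (fun A => ((2 : ℝ) : ℂ) • A) h0
  rw [← map_smul, h2, h1, smul_pauliComb, ← pauliComb_two_zero] at h3
  have h4 := (pauliComb_injective h3).2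
  exact (smul_eq_zero.mp h4.symm).resolve_left two_ne_zero

theorem weakOMP_iff_strongOMP_iff {N : QubitOp →ₗ[ℂ] QubitOp} {n : ℕ} {q : Fin n → ℝ}
    {ρ M : Fin n → QubitOp} (hM : IsOptimalMeasurement q ρ M)
    (huniq : ∀ M', IsOptimalMeasurement q ρ M' → M' = M) :
    (IsWeakOMP N q ρ ↔ IsOptimalMeasurement q (fun x => N (ρ x)) M) ∧
      (IsStrongOMP N q ρ ↔ IsOptimalMeasurement q (fun x => N (ρ x)) M) := by
  refine ⟨⟨?_, fun h => ⟨M, hM, h⟩⟩, fun h => (h M hM).2, ?_⟩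
  · rintro ⟨M', h, h'⟩
    rwa [huniq M' h] at h'
  · intro h M' hM'
    rw [huniq M' hM']
    exact ⟨hM, h⟩

end Auxiliary

/-! ### The characterization -/

theorem proposition3
    (q : Fin 2 → ℝ) (ρ : Fin 2 → QubitOp) (v : Fin 2 → Fin 3 → ℝ)
    (N : QubitOp →ₗ[ℂ] QubitOp) (D : Matrix (Fin 3) (Fin 3) ℝ) (t : Fin 3 → ℝ)
    (hq_nonneg : ∀ x, 0 ≤ q x) (hq_sum : ∑ x, q x = 1) (hq_lt : q 1 < q 0)
    (hρ : ∀ x, IsQubitState (ρ x)) (hv : ∀ x, ρ x = blochOp (v x))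
    (hmeas : q 0 < guessProb q ρ)
    (hN : IsCPTP N) (hDt : IsBlochForm N D t) :
    (IsWeakOMP N q ρ ↔
      ∃ lam ∈ LambdaRange q (guessProb q ρ), ∃ mu ∈ MuRange q (guessProb q ρ),
        t = -((D - lam • (1 : Matrix (Fin 3) (Fin 3) ℝ)).mulVec (helstromVec q v)) ∧
          mu = (1 - lam) * ((q 0 - q 1) / 2)) ∧
    (IsStrongOMP N q ρ ↔
      ∃ lam ∈ LambdaRange q (guessProb q ρ), ∃ mu ∈ MuRange q (guessProb q ρ),
        t = -((D - lam • (1 : Matrix (Fin 3) (Fin 3) ℝ)).mulVec (helstromVec q v)) ∧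
          mu = (1 - lam) * ((q 0 - q 1) / 2)) ∧
    (∀ lam mu : ℝ,
      (t = -((D - lam • (1 : Matrix (Fin 3) (Fin 3) ℝ)).mulVec (helstromVec q v)) ∧
          mu = (1 - lam) * ((q 0 - q 1) / 2)) ↔
        N (helstromOp q ρ) = (lam : ℂ) • helstromOp q ρ + (mu : ℂ) • (1 : QubitOp)) ∧
    (N 1 = 1 →
      t = 0 ∧
      (IsWeakOMP N q ρ ↔ ∃ lam ∈ LambdaRange q (guessProb q ρ),
        helstromVec q v ∈
          LinearMap.ker (D - lam • (1 : Matrix (Fin 3) (Fin 3) ℝ)).mulVecLin) ∧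
      (IsStrongOMP N q ρ ↔ ∃ lam ∈ LambdaRange q (guessProb q ρ),
        helstromVec q v ∈
          LinearMap.ker (D - lam • (1 : Matrix (Fin 3) (Fin 3) ℝ)).mulVecLin)) := by 
  obtain rfl : ρ = fun x => blochOp (v x) := funext hv
  have hd : 0 < q 0 - q 1 := sub_pos.mpr hq_lt
  have hsq := sq_lt_dotProduct_of_lt_guessProb hq_lt v hmeas
  have hw0 := (sq_nonneg _).trans hsq.le
  obtain ⟨n, hn, hnsq⟩ : ∃ n : ℝ, 0 ≤ n ∧
      n ^ 2 = (q 0 • v 0 - q 1 • v 1) ⬝ᵥ (q 0 • v 0 - q 1 • v 1) :=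
    ⟨_, Real.sqrt_nonneg _, Real.sq_sqrt hw0⟩
  have hdn : q 0 - q 1 < n := lt_of_pow_lt_pow_left₀ 2 hn (hnsq ▸ hsq)
  have hn0 : 0 < n := hd.trans hdn
  obtain ⟨u, hwu⟩ : ∃ u, q 0 • v 0 - q 1 • v 1 = n • u :=
    ⟨n⁻¹ • (q 0 • v 0 - q 1 • v 1), (smul_inv_smul₀ hn0.ne' _).symm⟩
  have hu : u ⬝ᵥ u = 1 := by
    rw [hwu, smul_dotProduct, dotProduct_smul, smul_eq_mul, smul_eq_mul, ← mul_assoc, ← sq] at hnsq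
    exact (mul_right_eq_self₀.mp hnsq.symm).resolve_right (by positivity)
  have hopt := (isOptimalMeasurement_blochMeasurement_iff hq_lt v hu).mpr
    ⟨n, hdn.le, hwu⟩
  have hsum : q 0 + q 1 = 1 := by rw [← hq_sum, Fin.sum_univ_two]
  have hP : guessProb q (fun x => blochOp (v x)) = (1 + n) / 2 := by
    rw [guessProb_eq_of_isOptimalMeasurement hopt, successProb_blochMeasurement q, hwu,
      dotProduct_smul, hu, smul_eq_mul]
    linarith
  have hlam : LambdaRange q (guessProb q fun x => blochOp (v x)) =
      Set.Icc ((q 0 - q 1) / n) 1 := by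
    rw [LambdaRange, hP, show 2 * q 0 - 1 = q 0 - q 1 by linarith,
      show 2 * ((1 + n) / 2) - 1 = n by ring]
  have hmu : ∀ lam ∈ LambdaRange q (guessProb q fun x => blochOp (v x)),
      (1 - lam) * ((q 0 - q 1) / 2) ∈ MuRange q (guessProb q fun x => blochOp (v x)) := by
    intro lam h
    rw [hlam] at h
    -- The upper end of `MuRange` is `(1 - λ) d / 2` at the least permissible `λ = d / n`, so the
    -- range of `μ` follows from that of `λ`.
    have hfac : ((1 + n) / 2 - q 0) / ((1 + n) / 2 - 1 / 2) = 1 - (q 0 - q 1) / n := by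
      rw [show (1 + n) / 2 - q 0 = (n - (q 0 - q 1)) / 2 by linarith,
        show (1 + n) / 2 - 1 / 2 = n / 2 by ring]
      field_simp
    rw [MuRange, hP, hfac]
    refine ⟨mul_nonneg (sub_nonneg.mpr h.2) (by positivity), ?_⟩
    rw [mul_comm]
    exact mul_le_mul_of_nonneg_left (by linarith [h.1]) (by positivity)
  obtain ⟨hweak, hstrong⟩ := weakOMP_iff_strongOMP_iff (N := N) hopt fun M hM =>
    eq_blochMeasurement_of_isOptimalMeasurement hq_lt v hu hdn hwu hM
  have hvec : ∀ lam : ℝ,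
      t = -((D - lam • (1 : Matrix (Fin 3) (Fin 3) ℝ)).mulVec (helstromVec q v)) ↔
        D.mulVec (q 0 • v 0 - q 1 • v 1) + (q 0 - q 1) • t = lam • (q 0 • v 0 - q 1 • v 1) :=
    fun lam => eq_neg_sub_smul_mulVec_iff hd.ne' lam
  have hmain := isOptimalMeasurement_map_iff hq_lt hN hDt hu hdn hwu
  simp only [← hlam, ← hvec] at hmain
  have hmain' : IsOptimalMeasurement q (fun x => N (blochOp (v x))) (blochMeasurement u) ↔
      ∃ lam ∈ LambdaRange q (guessProb q fun x => blochOp (v x)),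
        ∃ mu ∈ MuRange q (guessProb q fun x => blochOp (v x)),
          t = -((D - lam • (1 : Matrix (Fin 3) (Fin 3) ℝ)).mulVec (helstromVec q v)) ∧
            mu = (1 - lam) * ((q 0 - q 1) / 2) := by
    rw [hmain]
    constructor
    · rintro ⟨lam, h, ht⟩
      exact ⟨lam, h, _, hmu lam h, ht, rfl⟩
    · rintro ⟨lam, h, -, -, ht, -⟩
      exact ⟨lam, h, ht⟩
  refine ⟨hweak.trans hmain', hstrong.trans hmain', fun lam mu => ?_, fun h1 => ?_⟩
  · rw [map_helstromOp_eq_iff hDt, hvec]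
  · have ht := hDt.eq_zero_of_unital h1
    simp only [ht, zero_eq_neg] at hmain
    simp only [LinearMap.mem_ker, Matrix.mulVecLin_apply]
    exact ⟨ht, hweak.trans hmain, hstrong.trans hmain⟩
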